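/- Let $V$ be a finite-dimensional real inner product space and let $X_1,X_2,\ldots$ be independent, identically distributed $V$-valued random variables. Write $\Lambda(\lambda)=\log\mathbb{E}\big(e^{\langle\lambda,X_1\rangle}\big)$ and $\Psi(\lambda)=\mathbb{E}\big(\Lambda(Z\lambda)\big)$ with $Z\sim N(0,1)$, and assume that $\Lambda$ and $\Psi$ are finite on $V$ (that is, for every $\lambda\in V$, $e^{\langle\lambda,X_1\rangle}$ and $\Lambda(Z\lambda)$ are integrable). Let $\mathbb{S}=\prod_{n\ge1}\mathbb{S}^{n-1}$ be the product of the unit spheres $\mathbb{S}^{n-1}\subset\mathbb{R}^n$, and let $\sigma$ be any probability measure on $\mathbb{S}$ whose $n$-th marginal is the uniform distribution on $\mathbb{S}^{n-1}$ for every $n\ge1$. For $\theta=(\theta^n)_{n\ge1}\in\mathbb{S}$ and $0\le m\le n$ put $$W_m^{\theta^n}=\frac1{\sqrt n}\sum_{i=1}^m\theta_i^nX_i .$$ Then for $\sigma$-almost every $\theta$ the following holds: for all integers $k\ge1$ and all $\lambda\in V$, the expectations below are finite and $$\lim_{n\to\infty}\frac1n\log\mathbb{E}\Big(e^{\,n\langle\lambda,\,W^{\theta^n}_{\lfloor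 n/k\rfloor}\rangle}\Big)=\frac1k\,\Psi(\lambda).$$ -/

import Mathlib

open MeasureTheory ProbabilityTheory Filter Topology

noncomputable section

namespace WeightedWalk

/-- The product of all unit spheres `𝕊⁰ × 𝕊¹ × 𝕊² × ⋯`. The entry `θ n` is the weight vector
usually written `θ^{n+1}`, a unit vector of `ℝ^{n+1}`. -/
abbrev WeightArray : Type :=
  ∀ n : ℕ, Metric.sphere (0 : EuclideanSpace ℝ (Fin (n + 1))) 1

/-- The uniform probability measure on the unit sphere of `ℝ^{n+1}`: the normalised surface
measure. -/
def uniformSphere (n : ℕ) :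
    Measure (Metric.sphere (0 : EuclideanSpace ℝ (Fin (n + 1))) 1) :=
  ((volume : Measure (EuclideanSpace ℝ (Fin (n + 1)))).toSphere Set.univ)⁻¹ •
    (volume : Measure (EuclideanSpace ℝ (Fin (n + 1)))).toSphere

variable {Ω V : Type*} [MeasurableSpace Ω] [NormedAddCommGroup V] [InnerProductSpace ℝ V]

/-- The log-moment generating function `Λ(lam) = log E exp ⟨lam, Y⟩` of a random vector `Y`. -/
def logMGF (P : Measure Ω) (Y : Ω → V) (lam : V) : ℝ :=
  Real.log (∫ ω, Real.exp (inner ℝ lam (Y ω)) ∂P)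

/-- `Ψ(lam) = E Λ(Z lam)` with `Z` standard normal. -/
def Psi (P : Measure Ω) (Y : Ω → V) (lam : V) : ℝ :=
  ∫ z, logMGF P Y (z • lam) ∂(gaussianReal 0 1)

/-- For a weight vector `a = (a₁, …, a_N)`, the sum `N^{-1/2} ∑_{i ≤ m} aᵢ Xᵢ` of the first `m`
weighted steps (the steps `X₁, X₂, …` are numbered from `0` here). -/
def walk {N : ℕ} (a : EuclideanSpace ℝ (Fin N)) (X : ℕ → Ω → V) (m : ℕ) (ω : Ω) : V :=
  (1 / Real.sqrt N) • ∑ i ∈ Finset.univ.filter (fun i : Fin N => (i : ℕ) < m), a i • X i ω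

end WeightedWalk

end

/-! By independence the normalised log-moment generating function equals `(1/n) ∑_{i ≤ n/k} Λ(√n θ_i
λ)` exactly. It remains to show that the empirical measure of the rescaled weights `√n θ_i`, `i ≤
n/k`, converges to `N(0,1)` strongly enough to integrate `z ↦ Λ(zλ)`, off a null set independent of
`k` and `λ`.

A Gaussian vector has uniform direction, so a spherical event is at most as likely as any Gaussian
event containing the rays through it (`uniformSphere_le_stdPi`); the radius along a ray is
controlled through the sum of squares. Fourth moments make the Gaussian tails `O(n⁻²)`, and
Borel–Cantelli then needs only the marginals of `σ`, whatever the coupling. This is applied to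
countably many test functions, `cos (q z)` and `sin (q z)` with `q` rational
(`ae_tendsto_sum_scaled`), and to a bound on the averages of `exp (z²/32)`
(`exists_ae_eventually_sum_exp_sq_le`).

Lévy's continuity theorem turns this into weak convergence, and the exponential bound extends it to
continuous functions that are `o(exp (z²/32))` (`tendsto_sum_of_tendsto_trig`). Finiteness of `Ψ`
puts `Λ` in that class: `Λ` grows at least linearly along rays, so one large positive value would
persist on a whole window of Gaussian mass (`cgf_isLittleO_exp_sq`). -/

namespace WeightedWalk

/-! ### Polar decomposition of the Gaussian measure -/

/-- The standard Gaussian measure on `ℝ^N`, as a product measure. -/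
noncomputable abbrev stdPi (N : ℕ) : Measure (Fin N → ℝ) :=
  Measure.pi fun _ => gaussianReal 0 1

lemma stdPi_eq_withDensity (N : ℕ) :
    stdPi N = (volume : Measure (Fin N → ℝ)).withDensity
      (fun x => ENNReal.ofReal (∏ i, gaussianPDFReal 0 1 (x i))) := by
  refine Measure.pi_eq fun s hs => ?_
  have hm : MeasurableSet (Set.univ.pi s) := MeasurableSet.univ_pi hs
  have hInt : ∀ i, Integrable ((s i).indicator (gaussianPDFReal 0 1)) :=
    fun i => (integrable_gaussianPDFReal 0 1).indicator (hs i)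
  have hind : ∀ x : Fin N → ℝ,
      (Set.univ.pi s).indicator (fun x => ENNReal.ofReal (∏ i, gaussianPDFReal 0 1 (x i))) x
        = ENNReal.ofReal (∏ i, (s i).indicator (gaussianPDFReal 0 1) (x i)) := by
    intro x
    by_cases hx : x ∈ Set.univ.pi s
    · rw [Set.indicator_of_mem hx]
      congr 1
      refine Finset.prod_congr rfl fun i _ => ?_
      rw [Set.indicator_of_mem (hx i (Set.mem_univ i))]
    · rw [Set.indicator_of_notMem hx]
      simp only [Set.mem_pi, Set.mem_univ, true_imp_iff, not_forall] at hx
      obtain ⟨i, hi⟩ := hx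
      rw [Finset.prod_eq_zero (Finset.mem_univ i) (Set.indicator_of_notMem hi _)]
      simp
  have hprod : Integrable (fun x : Fin N → ℝ => ∏ i, (s i).indicator (gaussianPDFReal 0 1) (x i)) :=
    Integrable.fintype_prod (f := fun i => (s i).indicator (gaussianPDFReal 0 1)) hInt
  rw [withDensity_apply _ hm, ← lintegral_indicator hm]
  simp_rw [hind]
  rw [← ofReal_integral_eq_lintegral_ofReal hprod
      (ae_of_all _ fun x => Finset.prod_nonneg fun i _ =>
        Set.indicator_nonneg (fun _ _ => gaussianPDFReal_nonneg _ _ _) _),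
    integral_fintype_prod_volume_eq_prod (fun i => (s i).indicator (gaussianPDFReal 0 1)),
    ENNReal.ofReal_prod_of_nonneg fun i _ => integral_nonneg fun _ =>
        Set.indicator_nonneg (fun _ _ => gaussianPDFReal_nonneg _ _ _) _]
  refine Finset.prod_congr rfl fun i _ => ?_
  rw [gaussianReal_apply_eq_integral _ one_ne_zero, integral_indicator (hs i)]

/-- The density of the standard Gaussian measure on `ℝ^N` as a function of the norm. -/
noncomputable def radialDensity (N : ℕ) (r : ℝ) : ENNReal :=
  ENNReal.ofReal ((√(2 * Real.pi))⁻¹ ^ N * Real.exp (-r ^ 2 / 2))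

lemma measurable_radialDensity (N : ℕ) : Measurable (radialDensity N) := by
  unfold radialDensity; fun_prop

lemma map_stdPi_eq_withDensity (N : ℕ) :
    (stdPi N).map (WithLp.toLp 2) = (volume : Measure (EuclideanSpace ℝ (Fin N))).withDensity
      (fun x => radialDensity N ‖x‖) := by
  have hden : ∀ x : Fin N → ℝ, ENNReal.ofReal (∏ i, gaussianPDFReal 0 1 (x i))
      = radialDensity N ‖(WithLp.toLp 2 x : EuclideanSpace ℝ (Fin N))‖ := by
    intro x
    rw [radialDensity, EuclideanSpace.real_norm_sq_eq]
    simp [gaussianPDFReal, Finset.prod_mul_distrib, ← Real.exp_sum, neg_div, Finset.sum_div]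
  ext s hs
  have hmp := PiLp.volume_preserving_toLp (Fin N)
  rw [Measure.map_apply (by fun_prop) hs, stdPi_eq_withDensity,
    withDensity_apply _ (hs.preimage (by fun_prop)), withDensity_apply _ hs]
  simp_rw [hden]
  exact hmp.setLIntegral_comp_preimage hs
    ((measurable_radialDensity N).comp measurable_norm)

/-- The cone over a subset of the unit sphere, without its apex. -/
def cone {N : ℕ} (A : Set (Metric.sphere (0 : EuclideanSpace ℝ (Fin N)) 1)) :
    Set (EuclideanSpace ℝ (Fin N)) :=
  Subtype.val '' (homeomorphUnitSphereProd (EuclideanSpace ℝ (Fin N)) ⁻¹' (A ×ˢ Set.univ))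

lemma measurableSet_cone {N : ℕ} {A : Set (Metric.sphere (0 : EuclideanSpace ℝ (Fin N)) 1)}
    (hA : MeasurableSet A) : MeasurableSet (cone A) :=
  (measurableSet_singleton _).compl.subtype_image
    ((hA.prod .univ).preimage (homeomorphUnitSphereProd _).continuous.measurable)

/-- In polar coordinates the density depends on the radius only, so the integral over a cone
factorises. The radial factor never has to be evaluated. -/
lemma map_stdPi_cone {N : ℕ} {A : Set (Metric.sphere (0 : EuclideanSpace ℝ (Fin N)) 1)}
    (hA : MeasurableSet A) :
    (stdPi N).map (WithLp.toLp 2) (cone A) =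
      (volume : Measure (EuclideanSpace ℝ (Fin N))).toSphere A *
        ∫⁻ r, radialDensity N r.1 ∂(Measure.volumeIoiPow
          (Module.finrank ℝ (EuclideanSpace ℝ (Fin N)) - 1)) := by
  set E := EuclideanSpace ℝ (Fin N)
  have hmp := (volume : Measure E).measurePreserving_homeomorphUnitSphereProd
  have hrad : Measurable fun r : Set.Ioi (0 : ℝ) => radialDensity N r.1 :=
    (measurable_radialDensity N).comp measurable_subtype_coe
  rw [map_stdPi_eq_withDensity, withDensity_apply _ (measurableSet_cone hA), cone,
    ← setLIntegral_subtype (measurableSet_singleton _).compl _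
      (fun x : E => radialDensity N ‖x‖)]
  have h := hmp.setLIntegral_comp_preimage (hA.prod .univ) (hrad.comp measurable_snd)
  simp only [Function.comp_def, homeomorphUnitSphereProd_apply_snd_coe] at h
  rw [h, ← Measure.prod_restrict, Measure.restrict_univ]
  have := lintegral_prod_mul (μ := (volume : Measure E).toSphere.restrict A)
    (ν := Measure.volumeIoiPow (Module.finrank ℝ E - 1)) (f := fun _ => 1)
    aemeasurable_const hrad.aemeasurable
  simpa only [one_mul, lintegral_one, Measure.restrict_apply_univ] using this

/-- The uniform measure of a set on the sphere is bounded by the Gaussian measure of any set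
that contains the cone over it. -/
lemma uniformSphere_le_stdPi {n : ℕ}
    {A : Set (Metric.sphere (0 : EuclideanSpace ℝ (Fin (n + 1))) 1)} (hA : MeasurableSet A)
    {B : Set (Fin (n + 1) → ℝ)}
    (h : ∀ u ∈ A, ∀ r : ℝ, 0 < r → (fun i => r * u.1 i) ∈ B) :
    uniformSphere n A ≤ stdPi (n + 1) B := by
  set E := EuclideanSpace ℝ (Fin (n + 1))
  have huniv : (stdPi (n + 1)).map (WithLp.toLp 2) (cone (N := n + 1) Set.univ) = 1 := by
    have hc : cone (N := n + 1) Set.univ = {0}ᶜ := by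
      simp only [cone, Set.univ_prod_univ, Set.preimage_univ, Set.image_univ, Subtype.range_coe]
    have : IsProbabilityMeasure ((stdPi (n + 1)).map (WithLp.toLp 2 : _ → E)) :=
      Measure.isProbabilityMeasure_map (by fun_prop)
    rw [hc, prob_compl_eq_one_iff (measurableSet_singleton _), map_stdPi_eq_withDensity]
    exact withDensity_absolutelyContinuous _ _ (measure_singleton _)
  rw [map_stdPi_cone .univ] at huniv
  have hA' := map_stdPi_cone hA
  -- The full cone has mass one, which identifies the radial integral with the normalising constant
  -- of `uniformSphere`.
  rw [ENNReal.eq_inv_of_mul_eq_one_left ((mul_comm _ _).trans huniv)] at hA'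
  have hle : (stdPi (n + 1)).map (WithLp.toLp 2) (cone A) ≤ stdPi (n + 1) B := by
    rw [Measure.map_apply (by fun_prop) (measurableSet_cone hA)]
    refine measure_mono ?_
    rintro x ⟨y, hy, hyx⟩
    have := h _ hy.1 ‖y.1‖ (norm_pos_iff.2 y.2)
    convert this using 2 with i
    have hy0 : ‖y.1‖ ≠ 0 := norm_ne_zero_iff.2 y.2
    have : x i = y.1 i := by rw [hyx]
    simp [this, hy0]
  refine le_trans (le_of_eq ?_) hle
  rw [hA', uniformSphere, mul_comm]
  rfl

/-! ### Fourth moment tail bounds -/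

lemma integrable_pow_of_memLp {Ω : Type*} [MeasurableSpace Ω]
    {P : Measure Ω}
    [IsFiniteMeasure P] {f : Ω → ℝ} {n : ℕ} (hf : MemLp f n P) {k : ℕ} (hk : k ≤ n) :
    Integrable (fun ω => f ω ^ k) P := by
  have h : MemLp f k P := hf.mono_exponent (by exact_mod_cast hk)
  refine (h.integrable_norm_pow').mono' (h.1.pow k) (ae_of_all _ fun ω => ?_)
  simp

/-- Second and fourth moment bounds for sums of independent centred random variables. -/
lemma integral_sum_pow_four_le {Ω ι : Type*} [MeasurableSpace Ω] {P : Measure Ω}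
    [IsProbabilityMeasure P] {Y : ι → Ω → ℝ} (hm : ∀ i, Measurable (Y i)) (hi : iIndepFun Y P)
    (hL : ∀ i, MemLp (Y i) 4 P) (h0 : ∀ i, ∫ ω, Y i ω ∂P = 0) {v : ℝ}
    (h2 : ∀ i, ∫ ω, Y i ω ^ 2 ∂P ≤ v) (h4 : ∀ i, ∫ ω, Y i ω ^ 4 ∂P ≤ v ^ 2) (s : Finset ι) :
    ∫ ω, (∑ i ∈ s, Y i ω) ^ 2 ∂P ≤ s.card * v ∧
      ∫ ω, (∑ i ∈ s, Y i ω) ^ 4 ∂P ≤ 3 * (s.card * v) ^ 2 := by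
  classical
  induction s using Finset.induction_on with
  | empty => simp
  | insert a s ha ih =>
    obtain ⟨ih2, ih4⟩ := ih
    have hind : IndepFun (fun ω => ∑ i ∈ s, Y i ω) (Y a) P := by
      have := hi.indepFun_finsetSum_of_notMem hm ha
      simpa only [Finset.sum_fn] using this
    set S : Ω → ℝ := fun ω => ∑ i ∈ s, Y i ω with hS
    have hSL : MemLp S 4 P := memLp_finsetSum s fun i _ => hL i
    have iS : ∀ k ≤ 4, Integrable (fun ω => S ω ^ k) P := fun k hk =>
      integrable_pow_of_memLp (n := 4) (by exact_mod_cast hSL) hk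
    have iY : ∀ k ≤ 4, Integrable (fun ω => Y a ω ^ k) P := fun k hk =>
      integrable_pow_of_memLp (n := 4) (by exact_mod_cast hL a) hk
    have hp : ∀ j k : ℕ, IndepFun (fun ω => S ω ^ j) (fun ω => Y a ω ^ k) P := fun j k =>
      hind.comp (φ := fun x : ℝ => x ^ j) (ψ := fun x : ℝ => x ^ k) (by fun_prop) (by fun_prop)
    have iSY : ∀ j ≤ 4, ∀ k ≤ 4, Integrable (fun ω => S ω ^ j * Y a ω ^ k) P := fun j hj k hk =>
      (hp j k).integrable_mul (iS j hj) (iY k hk)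
    have eSY : ∀ j ≤ 4, ∀ k ≤ 4, ∫ ω, S ω ^ j * Y a ω ^ k ∂P
        = (∫ ω, S ω ^ j ∂P) * ∫ ω, Y a ω ^ k ∂P := fun j hj k hk =>
      (hp j k).integral_fun_mul_eq_mul_integral (iS j hj).1 (iY k hk).1
    have hS0 : ∫ ω, S ω ∂P = 0 := by
      rw [hS, integral_finsetSum _ fun i _ => (hL i).integrable (by norm_num)]
      simp [h0]
    have hY1 : ∫ ω, Y a ω ^ 1 ∂P = 0 := by simp [h0]
    have hS1 : ∫ ω, S ω ^ 1 ∂P = 0 := by simp [hS0]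
    have hexp : ∀ ω, ∑ i ∈ insert a s, Y i ω = S ω + Y a ω := fun ω => by
      rw [Finset.sum_insert ha, add_comm]
    have hv : 0 ≤ v := (integral_nonneg fun ω => sq_nonneg _).trans (h2 a)
    have hS2 : 0 ≤ ∫ ω, S ω ^ 2 ∂P := integral_nonneg fun ω => sq_nonneg _
    have hY2 : 0 ≤ ∫ ω, Y a ω ^ 2 ∂P := integral_nonneg fun ω => sq_nonneg _
    simp_rw [hexp]
    rw [Finset.card_insert_of_notMem ha]
    push_cast
    constructor
    · have e : ∀ ω, (S ω + Y a ω) ^ 2 = S ω ^ 2 + 2 * (S ω ^ 1 * Y a ω ^ 1) + Y a ω ^ 2 :=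
        fun ω => by ring
      simp_rw [e]
      rw [integral_add
        ((iS 2 (by norm_num)).fun_add ((iSY 1 (by norm_num) 1 (by norm_num)).const_mul 2))
        (iY 2 (by norm_num)), integral_add (iS 2 (by norm_num))
        ((iSY 1 (by norm_num) 1 (by norm_num)).const_mul 2), integral_const_mul,
        eSY 1 (by norm_num) 1 (by norm_num), hY1]
      linarith [h2 a]
    · have e : ∀ ω, (S ω + Y a ω) ^ 4 = S ω ^ 4 + 4 * (S ω ^ 3 * Y a ω ^ 1)
          + 6 * (S ω ^ 2 * Y a ω ^ 2) + 4 * (S ω ^ 1 * Y a ω ^ 3) + Y a ω ^ 4 :=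
        fun ω => by ring
      have i31 := (iSY 3 (by norm_num) 1 (by norm_num)).const_mul 4
      have i22 := (iSY 2 (by norm_num) 2 (by norm_num)).const_mul 6
      have i13 := (iSY 1 (by norm_num) 3 (by norm_num)).const_mul 4
      have i4 := iS 4 le_rfl
      simp_rw [e]
      rw [integral_add (((i4.fun_add i31).fun_add i22).fun_add i13) (iY 4 le_rfl),
        integral_add ((i4.fun_add i31).fun_add i22) i13, integral_add (i4.fun_add i31) i22,
        integral_add i4 i31, integral_const_mul, integral_const_mul, integral_const_mul,
        eSY 3 (by norm_num) 1 (by norm_num), eSY 2 (by norm_num) 2 (by norm_num),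
        eSY 1 (by norm_num) 3 (by norm_num), hY1, hS1]
      -- With `m = s.card`, the step is `3m²v² + 6mv² + v² ≤ 3(m+1)²v²`.
      have := mul_le_mul ih2 (h2 a) hY2 (by positivity)
      nlinarith [h4 a, sq_nonneg v]

/-- A fourth moment tail bound for sums of a function of independent Gaussian coordinates. -/
lemma exists_stdPi_sum_tail_le {g : ℝ → ℝ} (hg : Measurable g)
    (hgL : MemLp g 4 (gaussianReal 0 1)) :
    ∃ C : ℝ, ∀ (N : ℕ) (s : Finset (Fin N)) (ε : ℝ), 0 < N → 0 < ε →
      stdPi N {x | ε * N ≤ |∑ i ∈ s, (g (x i) - ∫ z, g z ∂(gaussianReal 0 1))|}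
        ≤ ENNReal.ofReal (C / ε ^ 4 * (1 / (N : ℝ) ^ 2)) := by
  set c := ∫ z, g z ∂(gaussianReal 0 1) with hc
  have hL : MemLp (fun z => g z - c) 4 (gaussianReal 0 1) := hgL.sub (memLp_const c)
  have i2 : Integrable (fun z => (g z - c) ^ 2) (gaussianReal 0 1) :=
    integrable_pow_of_memLp (n := 4) (by exact_mod_cast hL) (by norm_num)
  have i4 : Integrable (fun z => (g z - c) ^ 4) (gaussianReal 0 1) :=
    integrable_pow_of_memLp (n := 4) (by exact_mod_cast hL) (by norm_num)
  -- The added `1` serves twice: `t² ≤ 1 + t⁴` bounds the variance by `v`, and `v ≥ 1` bounds the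
  -- fourth moment by `v²`.
  set v := 1 + ∫ z, (g z - c) ^ 4 ∂(gaussianReal 0 1) with hv
  have hv4 : 0 ≤ ∫ z, (g z - c) ^ 4 ∂(gaussianReal 0 1) := integral_nonneg fun _ => by positivity
  have hv2 : ∫ z, (g z - c) ^ 2 ∂(gaussianReal 0 1) ≤ v := by
    have : ∫ z, (g z - c) ^ 2 ∂(gaussianReal 0 1)
        ≤ ∫ z, (1 + (g z - c) ^ 4) ∂(gaussianReal 0 1) :=
      integral_mono i2 ((integrable_const _).add i4) fun z => by
        show (g z - c) ^ 2 ≤ 1 + (g z - c) ^ 4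
        nlinarith [sq_nonneg ((g z - c) ^ 2 - 1), sq_nonneg ((g z - c))]
    rw [integral_add (integrable_const _) i4] at this
    simpa using this
  refine ⟨3 * v ^ 2, fun N s ε hN hε => ?_⟩
  have hN' : (0 : ℝ) < N := by exact_mod_cast hN
  have hmp : ∀ i : Fin N, MeasurePreserving (Function.eval i) (stdPi N) (gaussianReal 0 1) :=
    fun i => measurePreserving_eval _ i
  have hInt : ∀ (i : Fin N) (f : ℝ → ℝ), Measurable f →
      ∫ x, f (x i) ∂(stdPi N) = ∫ z, f z ∂(gaussianReal 0 1) := fun i f hf => by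
    rw [← (hmp i).map_eq, integral_map (measurable_pi_apply i).aemeasurable
      hf.aestronglyMeasurable]
  have hmem : ∀ i : Fin N, MemLp (fun x : Fin N → ℝ => g (x i) - c) 4 (stdPi N) := fun i =>
    hL.comp_measurePreserving (hmp i)
  have key := (integral_sum_pow_four_le (P := stdPi N) (Y := fun i x => g (x i) - c) (v := v)
    (fun i => by fun_prop) (iIndepFun_pi (X := fun _ z => g z - c) fun i => by fun_prop)
    hmem (fun i => ?_) (fun i => ?_) (fun i => ?_) s).2
  rotate_left
  · rw [hInt i (fun z => g z - c) (by fun_prop), integral_sub (hgL.integrable (by norm_num))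
      (integrable_const c)]
    simp [hc]
  · rw [hInt i (fun z => (g z - c) ^ 2) (by fun_prop)]; exact hv2
  · rw [hInt i (fun z => (g z - c) ^ 4) (by fun_prop)]; nlinarith
  have hSi : Integrable (fun x : Fin N → ℝ => (∑ i ∈ s, (g (x i) - c)) ^ 4) (stdPi N) :=
    integrable_pow_of_memLp (n := 4)
      (by exact_mod_cast memLp_finsetSum s fun i _ => hmem i) le_rfl
  have cheb := mul_meas_ge_le_integral_of_nonneg (μ := stdPi N)
    (ae_of_all _ fun x => by positivity) hSi ((ε * N) ^ 4)
  have hcard : (s.card : ℝ) ≤ N := by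
    exact_mod_cast (Finset.card_le_univ s).trans (by simp)
  have hreal : (stdPi N).real {x | (ε * N) ^ 4 ≤ (∑ i ∈ s, (g (x i) - c)) ^ 4}
      ≤ 3 * v ^ 2 / ε ^ 4 * (1 / (N : ℝ) ^ 2) := by
    have h1 : (s.card * v) ^ 2 ≤ (N * v) ^ 2 := by gcongr
    have h2 : 3 * v ^ 2 / ε ^ 4 * (1 / (N : ℝ) ^ 2) = 3 * (N * v) ^ 2 / (ε * N) ^ 4 := by
      field_simp
    rw [h2, le_div_iff₀ (by positivity), mul_comm]
    linarith
  refine (measure_mono fun x hx => ?_).trans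
    ((ENNReal.le_ofReal_iff_toReal_le (measure_ne_top _ _) (by positivity)).2 hreal)
  have : (ε * N) ^ 4 ≤ |∑ i ∈ s, (g (x i) - c)| ^ 4 := pow_le_pow_left₀ (by positivity) hx 4
  simpa [abs_pow, Even.pow_abs (by decide : Even 4)] using this

/-- The fourth power is `exp (z²/4)`, which the Gaussian factor `exp (-z²/2)` still dominates. -/
lemma memLp_exp_sq_gaussianReal :
    MemLp (fun z : ℝ => Real.exp (z ^ 2 / 16)) 4 (gaussianReal 0 1) := by
  rw [← integrable_norm_rpow_iff (by fun_prop) (by norm_num) (by norm_num),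
    gaussianReal_of_var_ne_zero _ one_ne_zero,
    integrable_withDensity_iff_integrable_smul' (measurable_gaussianPDF 0 1)
      (ae_of_all _ fun x => gaussianPDF_lt_top)]
  refine ((integrable_exp_neg_mul_sq (b := 1 / 4) (by norm_num)).const_mul
    (√(2 * Real.pi))⁻¹).congr (ae_of_all _ fun x => ?_)
  simp only [toReal_gaussianPDF, gaussianPDFReal, Real.norm_eq_abs, Real.abs_exp, smul_eq_mul,
    NNReal.coe_one, mul_one, sub_zero, ENNReal.toReal_ofNat]
  rw [← Real.exp_mul, mul_assoc, ← Real.exp_add]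
  congr 2
  ring

lemma memLp_sq_gaussianReal : MemLp (fun z : ℝ => z ^ 2) 4 (gaussianReal 0 1) := by
  refine memLp_exp_sq_gaussianReal.of_le_mul (c := 16) (by fun_prop) (ae_of_all _ fun z => ?_)
  rw [Real.norm_of_nonneg (by positivity), Real.norm_of_nonneg (by positivity)]
  linarith [Real.add_one_le_exp (z ^ 2 / 16)]

lemma integral_sq_gaussianReal : ∫ z, z ^ 2 ∂(gaussianReal 0 1) = 1 := by
  have h := variance_fun_id_gaussianReal (μ := 0) (v := 1)
  rw [variance_of_integral_eq_zero (by fun_prop) integral_id_gaussianReal] at h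
  simpa using h

/-! ### Empirical averages over uniform weights -/

/-- The coordinates of a weight vector, scaled to be approximately standard Gaussian. -/
noncomputable def scaled {n : ℕ} (u : Metric.sphere (0 : EuclideanSpace ℝ (Fin (n + 1))) 1)
    (i : Fin (n + 1)) : ℝ :=
  √((n + 1 : ℕ) : ℝ) * u.1 i

lemma measurable_scaled {n : ℕ} (i : Fin (n + 1)) : Measurable fun u => scaled (n := n) u i := by
  unfold scaled
  have : Continuous fun u : Metric.sphere (0 : EuclideanSpace ℝ (Fin (n + 1))) 1 => u.1 i := by
    fun_prop
  exact this.measurable.const_mul _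

lemma sum_sq_sphere {n : ℕ} (u : Metric.sphere (0 : EuclideanSpace ℝ (Fin (n + 1))) 1) :
    ∑ i, u.1 i ^ 2 = 1 := by
  rw [← EuclideanSpace.real_norm_sq_eq, norm_eq_of_mem_sphere u, one_pow]

lemma sum_abs_sphere_le {n : ℕ} (u : Metric.sphere (0 : EuclideanSpace ℝ (Fin (n + 1))) 1) :
    ∑ i, |u.1 i| ≤ √((n + 1 : ℕ) : ℝ) := by
  refine Real.le_sqrt_of_sq_le ?_
  have h := sq_sum_le_card_mul_sum_sq (s := Finset.univ) (f := fun i => |u.1 i|)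
  simpa [sum_sq_sphere] using h

lemma sum_sq_sub_one_ray {n : ℕ} (u : Metric.sphere (0 : EuclideanSpace ℝ (Fin (n + 1))) 1)
    (r : ℝ) : ∑ i, ((r * u.1 i) ^ 2 - 1) = r ^ 2 - ((n + 1 : ℕ) : ℝ) := by
  simp_rw [mul_pow]
  rw [Finset.sum_sub_distrib, ← Finset.mul_sum, sum_sq_sphere]
  simp

/-- Replacing a point of a ray by its rescaling to radius `√(n + 1)` changes the sum of a
Lipschitz function of the coordinates by a controlled amount. -/
lemma abs_sum_scaled_sub_le {n : ℕ} (u : Metric.sphere (0 : EuclideanSpace ℝ (Fin (n + 1))) 1)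
    {r : ℝ} (hr : 0 < r) {g : ℝ → ℝ} {L : NNReal} (hg : LipschitzWith L g)
    (s : Finset (Fin (n + 1))) :
    |∑ i ∈ s, g (scaled u i) - ∑ i ∈ s, g (r * u.1 i)| ≤ L * |r ^ 2 - ((n + 1 : ℕ) : ℝ)| := by
  set N : ℝ := ((n + 1 : ℕ) : ℝ)
  have hN : 0 ≤ N := by positivity
  rw [← Finset.sum_sub_distrib]
  calc |∑ i ∈ s, (g (scaled u i) - g (r * u.1 i))|
      ≤ ∑ i ∈ s, |g (scaled u i) - g (r * u.1 i)| := Finset.abs_sum_le_sum_abs _ _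
    _ ≤ ∑ i ∈ s, L * (|√N - r| * |u.1 i|) := by
        refine Finset.sum_le_sum fun i _ => ?_
        have := hg.dist_le_mul (scaled u i) (r * u.1 i)
        rw [Real.dist_eq, Real.dist_eq, scaled, ← sub_mul, abs_mul] at this
        exact this
    _ ≤ ∑ i, L * (|√N - r| * |u.1 i|) :=
        Finset.sum_le_sum_of_subset_of_nonneg (Finset.subset_univ s) fun i _ _ => by positivity
    _ = L * (|√N - r| * ∑ i, |u.1 i|) := by rw [Finset.mul_sum, Finset.mul_sum]
    -- Enlarging `√N` to `√N + r` produces a difference of squares, which is the centred sum of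
    -- squares along the ray.
    _ ≤ L * (|√N - r| * |√N + r|) := by
        gcongr
        exact (sum_abs_sphere_le u).trans ((le_add_of_nonneg_right hr.le).trans (le_abs_self _))
    _ = L * |r ^ 2 - N| := by
        rw [← abs_mul, abs_sub_comm (r ^ 2)]
        congr 2
        nlinarith [Real.sq_sqrt hN]

variable {σ : Measure WeightArray}

/-- The first Borel–Cantelli lemma: summability suffices, so no relation between different `θ n`
enters. -/
lemma ae_eventually_notMem_of_uniformSphere_le (hσ : ∀ n, σ.map (fun θ => θ n) = uniformSphere n)
    (A : ∀ n, Set (Metric.sphere (0 : EuclideanSpace ℝ (Fin (n + 1))) 1)) (C : ℝ)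
    (hA : ∀ n, uniformSphere n (A n) ≤ ENNReal.ofReal (C * (1 / ((n + 1 : ℕ) : ℝ) ^ 2))) :
    ∀ᵐ θ ∂σ, ∀ᶠ n in atTop, θ n ∉ A n := by
  refine ae_eventually_notMem (s := fun n => {θ : WeightArray | θ n ∈ A n}) ?_
  have hsum : Summable fun n : ℕ => C * (1 / ((n + 1 : ℕ) : ℝ) ^ 2) :=
    ((summable_nat_add_iff 1).2 (Real.summable_one_div_nat_pow.2 one_lt_two)).mul_left C
  refine ne_top_of_le_ne_top hsum.tsum_ofReal_ne_top (ENNReal.tsum_le_tsum fun n => ?_)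
  refine le_trans ?_ (hA n)
  rw [← hσ n]
  exact Measure.le_map_apply (f := fun θ : WeightArray => θ n)
    (measurable_pi_apply n).aemeasurable (A n)

/-- Empirical averages of bounded Lipschitz functions of the scaled weights converge almost
surely to their Gaussian mean. -/
lemma ae_tendsto_sum_scaled (hσ : ∀ n, σ.map (fun θ => θ n) = uniformSphere n)
    {g : ℝ → ℝ} {L : NNReal} (hg : LipschitzWith L g) {M : ℝ} (hM : ∀ x, |g x| ≤ M)
    (s : ∀ n, Finset (Fin (n + 1))) :
    ∀ᵐ θ ∂σ, Tendsto (fun n : ℕ => (1 / ((n + 1 : ℕ) : ℝ)) *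
      ∑ i ∈ s n, (g (scaled (θ n) i) - ∫ z, g z ∂(gaussianReal 0 1))) atTop (𝓝 0) := by
  set c := ∫ z, g z ∂(gaussianReal 0 1) with hc
  have hgm : Measurable g := hg.continuous.measurable
  obtain ⟨C₁, hC₁⟩ := exists_stdPi_sum_tail_le hgm
    (MemLp.of_bound hgm.aestronglyMeasurable M (ae_of_all _ hM))
  obtain ⟨C₂, hC₂⟩ := exists_stdPi_sum_tail_le (g := fun z => z ^ 2) (by fun_prop)
    memLp_sq_gaussianReal
  have key : ∀ ε : ℝ, 0 < ε → ∀ᵐ θ ∂σ, ∀ᶠ n : ℕ in atTop,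
      ¬ ε * ((n + 1 : ℕ) : ℝ) ≤ |∑ i ∈ s n, (g (scaled (θ n) i) - c)| := by
    intro ε hε
    -- A radius error below `δN` costs at most `εN/2` in the sum; `L + 1` avoids dividing by zero.
    set δ := ε / (2 * (L + 1)) with hδ
    have hδ0 : 0 < δ := by positivity
    refine ae_eventually_notMem_of_uniformSphere_le hσ
      (fun n => {u | ε * ((n + 1 : ℕ) : ℝ) ≤ |∑ i ∈ s n, (g (scaled u i) - c)|})
      (|C₁| / (ε / 2) ^ 4 + |C₂| / δ ^ 4) fun n => ?_
    have hmeas : MeasurableSet {u : Metric.sphere (0 : EuclideanSpace ℝ (Fin (n + 1))) 1 |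
        ε * ((n + 1 : ℕ) : ℝ) ≤ |∑ i ∈ s n, (g (scaled u i) - c)|} := by
      refine measurableSet_le measurable_const (Measurable.abs ?_)
      exact Finset.measurable_sum _ fun i _ =>
        (hgm.comp (measurable_scaled i)).sub measurable_const
    refine (uniformSphere_le_stdPi hmeas
      (B := {x | ε / 2 * ((n + 1 : ℕ) : ℝ) ≤ |∑ i ∈ s n, (g (x i) - c)|} ∪
        {x | δ * ((n + 1 : ℕ) : ℝ) ≤ |∑ i, (x i ^ 2 - ∫ z, z ^ 2 ∂(gaussianReal 0 1))|})
      fun u hu r hr => ?_).trans ?_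
    · by_contra hcon
      simp only [Set.mem_union, Set.mem_ofPred_eq, not_or, not_le, integral_sq_gaussianReal,
        sum_sq_sub_one_ray] at hcon hu
      obtain ⟨h1, h2⟩ := hcon
      have h3 := abs_sum_scaled_sub_le u hr hg (s n)
      have h4 : (L : ℝ) * |r ^ 2 - ((n + 1 : ℕ) : ℝ)| ≤ ε / 2 * ((n + 1 : ℕ) : ℝ) := by
        calc (L : ℝ) * |r ^ 2 - ((n + 1 : ℕ) : ℝ)| ≤ (L + 1) * (δ * ((n + 1 : ℕ) : ℝ)) := by
              gcongr
              linarith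
          _ = ε / 2 * ((n + 1 : ℕ) : ℝ) := by rw [hδ]; field_simp
      have h5 : ∑ i ∈ s n, (g (scaled u i) - c) =
          (∑ i ∈ s n, g (scaled u i) - ∑ i ∈ s n, g (r * u.1 i))
            + ∑ i ∈ s n, (g (r * u.1 i) - c) := by
        rw [Finset.sum_sub_distrib, Finset.sum_sub_distrib]; ring
      rw [h5] at hu
      have h6 := abs_add_le (∑ i ∈ s n, g (scaled u i) - ∑ i ∈ s n, g (r * u.1 i))
        (∑ i ∈ s n, (g (r * u.1 i) - c))
      linarith
    · refine (measure_union_le _ _).trans ?_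
      refine (add_le_add (hC₁ (n + 1) (s n) _ n.succ_pos (by positivity))
        (hC₂ (n + 1) Finset.univ δ n.succ_pos hδ0)).trans ?_
      rw [add_mul, ENNReal.ofReal_add (by positivity) (by positivity)]
      gcongr
      · exact le_abs_self _
      · exact le_abs_self _
  have key' : ∀ᵐ θ ∂σ, ∀ j : ℕ, ∀ᶠ n : ℕ in atTop,
      ¬ (1 / ((j : ℝ) + 1)) * ((n + 1 : ℕ) : ℝ) ≤ |∑ i ∈ s n, (g (scaled (θ n) i) - c)| :=
    ae_all_iff.2 fun j => key _ (by positivity)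
  filter_upwards [key'] with θ hθ
  rw [Metric.tendsto_nhds]
  intro ε hε
  obtain ⟨j, hj⟩ := exists_nat_one_div_lt hε
  filter_upwards [hθ j] with n hn
  have hN : (0 : ℝ) < ((n + 1 : ℕ) : ℝ) := by positivity
  rw [Real.dist_eq, sub_zero, abs_mul, abs_of_pos (by positivity), one_div, inv_mul_lt_iff₀ hN]
  rw [not_le] at hn
  calc _ < _ := hn
    _ ≤ ε * ((n + 1 : ℕ) : ℝ) := by gcongr
    _ = _ := mul_comm _ _

/-- Empirical Gaussian-exponential moments of the scaled weights are almost surely bounded. -/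
lemma exists_ae_eventually_sum_exp_sq_le (hσ : ∀ n, σ.map (fun θ => θ n) = uniformSphere n) :
    ∃ K : ℝ, ∀ᵐ θ ∂σ, ∀ᶠ n : ℕ in atTop,
      ∑ i, Real.exp (scaled (θ n) i ^ 2 / 32) ≤ K * ((n + 1 : ℕ) : ℝ) := by
  set c := ∫ z, Real.exp (z ^ 2 / 16) ∂(gaussianReal 0 1) with hc
  obtain ⟨C₁, hC₁⟩ := exists_stdPi_sum_tail_le (g := fun z => Real.exp (z ^ 2 / 16)) (by fun_prop)
    memLp_exp_sq_gaussianReal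
  obtain ⟨C₂, hC₂⟩ := exists_stdPi_sum_tail_le (g := fun z => z ^ 2) (by fun_prop)
    memLp_sq_gaussianReal
  refine ⟨c + 1, ?_⟩
  have key := ae_eventually_notMem_of_uniformSphere_le hσ
    (fun n => {u | (c + 1) * ((n + 1 : ℕ) : ℝ) < ∑ i, Real.exp (scaled u i ^ 2 / 32)})
    (|C₁| / 1 ^ 4 + |C₂| / (1 / 2) ^ 4) fun n => ?_
  · filter_upwards [key] with θ hθ
    filter_upwards [hθ] with n hn
    exact not_lt.1 hn
  have hmeas : MeasurableSet {u : Metric.sphere (0 : EuclideanSpace ℝ (Fin (n + 1))) 1 |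
      (c + 1) * ((n + 1 : ℕ) : ℝ) < ∑ i, Real.exp (scaled u i ^ 2 / 32)} := by
    refine measurableSet_lt measurable_const ?_
    exact Finset.measurable_sum _ fun i _ =>
      Real.measurable_exp.comp (((measurable_scaled i).pow_const 2).div_const 32)
  refine (uniformSphere_le_stdPi hmeas
    (B := {x | 1 * ((n + 1 : ℕ) : ℝ) ≤ |∑ i, (Real.exp (x i ^ 2 / 16) - c)|} ∪
      {x | 1 / 2 * ((n + 1 : ℕ) : ℝ) ≤ |∑ i, (x i ^ 2 - ∫ z, z ^ 2 ∂(gaussianReal 0 1))|})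
    fun u hu r hr => ?_).trans ?_
  · by_contra hcon
    simp only [Set.mem_union, Set.mem_ofPred_eq, not_or, not_le, integral_sq_gaussianReal,
      sum_sq_sub_one_ray] at hcon hu
    obtain ⟨h1, h2⟩ := hcon
    -- The factor `2` lost here is why the exponent drops from `z²/16` to `z²/32`.
    have hr2 : ((n + 1 : ℕ) : ℝ) ≤ 2 * r ^ 2 := by linarith [(abs_lt.1 h2).1]
    have h3 : ∑ i, Real.exp (scaled u i ^ 2 / 32) ≤ ∑ i, Real.exp ((r * u.1 i) ^ 2 / 16) := by
      refine Finset.sum_le_sum fun i _ => Real.exp_le_exp.2 ?_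
      rw [scaled, mul_pow, mul_pow, Real.sq_sqrt (by positivity)]
      nlinarith [sq_nonneg (u.1 i)]
    have h4 : ∑ i : Fin (n + 1), (Real.exp ((r * u.1 i) ^ 2 / 16) - c) =
        ∑ i, Real.exp ((r * u.1 i) ^ 2 / 16) - ((n + 1 : ℕ) : ℝ) * c := by
      rw [Finset.sum_sub_distrib]; simp
    rw [h4] at h1
    linarith [(abs_lt.1 h1).2]
  · refine (measure_union_le _ _).trans ?_
    refine (add_le_add (hC₁ (n + 1) Finset.univ 1 n.succ_pos one_pos)
      (hC₂ (n + 1) Finset.univ (1 / 2) n.succ_pos (by norm_num))).trans ?_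
    rw [add_mul, ENNReal.ofReal_add (by positivity) (by positivity)]
    gcongr
    · exact le_abs_self _
    · exact le_abs_self _

/-! ### From trigonometric averages to unbounded test functions -/

/-- Weak convergence upgrades to convergence of integrals of a continuous function that is
negligible at infinity with respect to a weight whose integrals are bounded. -/
lemma tendsto_integral_of_tendsto_of_weight {μ : ℕ → ProbabilityMeasure ℝ}
    {ν : ProbabilityMeasure ℝ} (hμ : Tendsto μ atTop (𝓝 ν)) {f w : ℝ → ℝ} (hf : Continuous f)
    (hw : ∀ z, 0 ≤ w z) {K : ℝ} (hwK : ∀ᶠ n in atTop, ∫ z, w z ∂(μ n : Measure ℝ) ≤ K)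
    (hwμ : ∀ n, Integrable w (μ n : Measure ℝ)) (hwν : Integrable w (ν : Measure ℝ))
    (hfμ : ∀ n, Integrable f (μ n : Measure ℝ)) (hfν : Integrable f (ν : Measure ℝ))
    (hfw : ∀ ε > 0, ∃ R : ℝ, ∀ z, R ≤ |z| → |f z| ≤ ε * w z) :
    Tendsto (fun n => ∫ z, f z ∂(μ n : Measure ℝ)) atTop (𝓝 (∫ z, f z ∂(ν : Measure ℝ))) := by
  rw [Metric.tendsto_nhds]
  intro η hη
  -- Both truncation errors together stay below `η/2`; the summand `1` makes `K'` positive.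
  set K' := |K| + ∫ z, w z ∂(ν : Measure ℝ) + 1 with hK'
  have hwν0 : 0 ≤ ∫ z, w z ∂(ν : Measure ℝ) := integral_nonneg hw
  have hK'0 : 0 < K' := by positivity
  obtain ⟨R, hR⟩ := hfw (η / (2 * K')) (by positivity)
  set ε := η / (2 * K') with hε
  -- A continuous cutoff, equal to `1` for `|z| ≤ R` when `R ≥ 0` and to `0` for `|z| ≥ R + 1`.
  set χ : ℝ → ℝ := fun z => max 0 (min 1 (R + 1 - |z|)) with hχ
  have hχc : Continuous χ := by fun_prop
  have hχ0 : ∀ z, 0 ≤ χ z := fun z => le_max_left _ _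
  have hχ1 : ∀ z, χ z ≤ 1 := fun z => max_le zero_le_one (min_le_left _ _)
  have hbound : ∃ C, ∀ z, ‖f z * χ z‖ ≤ C := by
    obtain ⟨C, hC⟩ := (isCompact_closedBall (0 : ℝ) (R + 1)).exists_bound_of_continuousOn
      (f := fun z => f z * χ z) (by fun_prop)
    refine ⟨max C 0, fun z => ?_⟩
    by_cases hz : |z| ≤ R + 1
    · exact (hC z (by simpa using hz)).trans (le_max_left _ _)
    · have : χ z = 0 := max_eq_left ((min_le_right _ _).trans (by linarith))
      simp [this]
  obtain ⟨C, hC⟩ := hbound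
  let F : BoundedContinuousFunction ℝ ℝ :=
    BoundedContinuousFunction.ofNormedAddCommGroup (fun z => f z * χ z) (by fun_prop) C hC
  have hdiff : ∀ z, ‖f z - F z‖ ≤ ε * w z := by
    intro z
    have hF : F z = f z * χ z := rfl
    rw [hF, Real.norm_eq_abs]
    by_cases hz : R ≤ |z|
    · refine le_trans ?_ (hR z hz)
      have e : f z - f z * χ z = f z * (1 - χ z) := by ring
      rw [e, abs_mul, abs_of_nonneg (sub_nonneg.2 (hχ1 z))]
      exact mul_le_of_le_one_right (abs_nonneg _) (by linarith [hχ0 z])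
    · have h1 : χ z = 1 := by
        rw [hχ]
        simp only
        rw [min_eq_left (by linarith), max_eq_right zero_le_one]
      rw [h1, mul_one, sub_self, abs_zero]
      exact mul_nonneg (by positivity) (hw z)
  have hclose : ∀ ρ : ProbabilityMeasure ℝ, Integrable w (ρ : Measure ℝ) →
      Integrable f (ρ : Measure ℝ) →
      |∫ z, f z ∂(ρ : Measure ℝ) - ∫ z, F z ∂(ρ : Measure ℝ)|
        ≤ ε * ∫ z, w z ∂(ρ : Measure ℝ) := by
    intro ρ hwρ hfρ
    rw [← integral_sub hfρ (F.integrable _), ← integral_const_mul, ← Real.norm_eq_abs]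
    exact norm_integral_le_of_norm_le (hwρ.const_mul ε) (ae_of_all _ hdiff)
  have hF := (ProbabilityMeasure.tendsto_iff_forall_integral_tendsto.1 hμ) F
  rw [Metric.tendsto_nhds] at hF
  filter_upwards [hwK, hF (η / 2) (by positivity)] with n hn hFn
  rw [Real.dist_eq] at hFn ⊢
  have h1 := hclose (μ n) (hwμ n) (hfμ n)
  have h2 := hclose ν hwν hfν
  have h3 : ε * ∫ z, w z ∂(μ n : Measure ℝ) ≤ ε * |K| := by
    gcongr
    exact hn.trans (le_abs_self K)
  have h4 : ε * |K| + ε * ∫ z, w z ∂(ν : Measure ℝ) + ε = η / 2 := by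
    rw [← mul_add, ← mul_add_one, ← hK', hε]
    field_simp
  have h5 : 0 < ε := by positivity
  rw [abs_le] at h1 h2
  rw [abs_lt] at hFn ⊢
  constructor <;> linarith

/-- Pointwise convergence extends from the rationals to the reals for eventually uniformly
Lipschitz functions. -/
lemma tendsto_of_tendsto_rat {F : ℕ → ℝ → ℂ} {G : ℝ → ℂ} (hG : Continuous G) {D : ℝ}
    (hF : ∀ᶠ n in atTop, ∀ t t', dist (F n t) (F n t') ≤ D * |t - t'|)
    (hq : ∀ q : ℚ, Tendsto (fun n => F n q) atTop (𝓝 (G q))) (t : ℝ) :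
    Tendsto (fun n => F n t) atTop (𝓝 (G t)) := by
  rw [Metric.tendsto_nhds]
  intro ε hε
  have h1 : ∀ᶠ t' in 𝓝 t, dist (G t') (G t) < ε / 3 :=
    hG.continuousAt.eventually (Metric.ball_mem_nhds _ (by positivity))
  have h2 : ∀ᶠ t' in 𝓝 t, |D| * |t - t'| < ε / 3 := by
    have : Tendsto (fun t' => |D| * |t - t'|) (𝓝 t) (𝓝 (|D| * |t - t|)) := by
      apply Continuous.tendsto; fun_prop
    rw [sub_self, abs_zero, mul_zero] at this
    exact this.eventually (gt_mem_nhds (by positivity))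
  obtain ⟨q, hq1, hq2⟩ := Rat.denseRange_cast.exists_mem_open isOpen_interior
    ((mem_interior_iff_mem_nhds.2 (h1.and h2)) |> fun h => ⟨t, h⟩) |>.imp
      fun q h => interior_subset h
  filter_upwards [hF, (Metric.tendsto_nhds.1 (hq q)) (ε / 3) (by positivity)] with n hn hn'
  have h3 := hn t q
  have h4 : D * |t - q| ≤ |D| * |t - q| := by gcongr; exact le_abs_self D
  have h5 := dist_triangle4 (F n t) (F n q) (G q) (G t)
  linarith

/-- The uniform distribution on the values `y i`, `i ∈ s`. -/
noncomputable def empirical {ι : Type*} (s : Finset ι) (y : ι → ℝ) : Measure ℝ :=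
  (s.card : ENNReal)⁻¹ • ∑ i ∈ s, Measure.dirac (y i)

lemma isProbabilityMeasure_empirical {ι : Type*} {s : Finset ι} (hs : s.Nonempty) (y : ι → ℝ) :
    IsProbabilityMeasure (empirical s y) := by
  refine ⟨?_⟩
  rw [empirical, Measure.smul_apply, Measure.finsetSum_apply]
  simp only [measure_univ, Finset.sum_const, nsmul_eq_mul, mul_one, smul_eq_mul]
  exact ENNReal.inv_mul_cancel (by simpa using hs.ne_empty) (by simp)

lemma integrable_empirical {ι : Type*} {s : Finset ι} (hs : s.Nonempty) (y : ι → ℝ)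
    {E : Type*} [NormedAddCommGroup E] {f : ℝ → E} (hf : StronglyMeasurable f) :
    Integrable f (empirical s y) := by
  refine Integrable.smul_measure ?_ (by simpa using hs.ne_empty)
  exact integrable_finsetSum_measure.2 fun i _ => integrable_dirac' hf (by simp)

lemma integral_empirical {ι : Type*} (s : Finset ι) (y : ι → ℝ)
    {E : Type*} [NormedAddCommGroup E] [NormedSpace ℝ E] [CompleteSpace E] {f : ℝ → E}
    (hf : StronglyMeasurable f) :
    ∫ z, f z ∂(empirical s y) = (s.card : ℝ)⁻¹ • ∑ i ∈ s, f (y i) := by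
  rw [empirical, integral_smul_measure,
    integral_finsetSum_measure fun i _ => integrable_dirac' hf (by simp)]
  simp

lemma integrable_cos_gaussianReal (t : ℝ) :
    Integrable (fun z => Real.cos (t * z)) (gaussianReal 0 1) :=
  Integrable.of_bound (by fun_prop) 1 (ae_of_all _ fun z => Real.abs_cos_le_one _)

lemma integrable_sin_gaussianReal (t : ℝ) :
    Integrable (fun z => Real.sin (t * z)) (gaussianReal 0 1) :=
  Integrable.of_bound (by fun_prop) 1 (ae_of_all _ fun z => Real.abs_sin_le_one _)

lemma cexp_mul_I_eq (t z : ℝ) :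
    Complex.exp (t * z * Complex.I) =
      (Real.cos (t * z) : ℂ) + (Real.sin (t * z) : ℂ) * Complex.I := by
  rw [Complex.exp_mul_I]
  push_cast
  rfl

lemma charFun_gaussianReal_eq (t : ℝ) :
    charFun (gaussianReal 0 1) t = ((∫ z, Real.cos (t * z) ∂(gaussianReal 0 1) : ℝ) : ℂ)
      + ((∫ z, Real.sin (t * z) ∂(gaussianReal 0 1) : ℝ) : ℂ) * Complex.I := by
  rw [charFun_apply_real]
  simp_rw [cexp_mul_I_eq]
  rw [integral_add (integrable_cos_gaussianReal t).ofReal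
    ((integrable_sin_gaussianReal t).ofReal.mul_const _), integral_mul_const,
    integral_complex_ofReal, integral_complex_ofReal]

lemma charFun_empirical {ι : Type*} (s : Finset ι) (y : ι → ℝ) (t : ℝ) :
    charFun (empirical s y) t = (s.card : ℝ)⁻¹ • ∑ i ∈ s, Complex.exp (t * y i * Complex.I) := by
  rw [charFun_apply_real, integral_empirical s y
    (f := fun z : ℝ => Complex.exp (t * z * Complex.I))
    (Continuous.stronglyMeasurable (by fun_prop))]

lemma dist_charFun_empirical_le {ι : Type*} (s : Finset ι) (y : ι → ℝ) (t t' : ℝ) :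
    dist (charFun (empirical s y) t) (charFun (empirical s y) t')
      ≤ ((s.card : ℝ)⁻¹ * ∑ i ∈ s, |y i|) * |t - t'| := by
  rw [charFun_empirical, charFun_empirical, dist_eq_norm, ← smul_sub, ← Finset.sum_sub_distrib,
    norm_smul, Real.norm_of_nonneg (by positivity), mul_assoc]
  gcongr
  rw [Finset.sum_mul]
  refine (norm_sum_le _ _).trans (Finset.sum_le_sum fun i _ => ?_)
  have e : Complex.exp (t * y i * Complex.I) - Complex.exp (t' * y i * Complex.I)
      = Complex.exp ((t' * y i : ℝ) * Complex.I) *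
        (Complex.exp (Complex.I * ((t - t') * y i : ℝ)) - 1) := by
    rw [mul_sub, ← Complex.exp_add, mul_one]
    push_cast
    congr 2
    ring
  rw [e, norm_mul, Complex.norm_exp_ofReal_mul_I, one_mul]
  refine (Real.norm_exp_I_mul_ofReal_sub_one_le).trans ?_
  rw [Real.norm_eq_abs, abs_mul, mul_comm]

/-- Lets the exponential bound also control first absolute moments, hence the Lipschitz constants of
the empirical characteristic functions. -/
lemma abs_le_mul_exp_sq (z : ℝ) : |z| ≤ 32 * Real.exp (z ^ 2 / 32) := by
  have := Real.add_one_le_exp (z ^ 2 / 32)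
  nlinarith [sq_nonneg (|z| - 1), sq_abs z]

/-- If the empirical averages of `cos (q z)` and `sin (q z)`, `q` rational, converge to their
Gaussian means and the averages of `exp (z ^ 2 / 32)` stay bounded, then the averages of every
continuous function `f = o(exp (z ^ 2 / 32))` converge. -/
lemma tendsto_sum_of_tendsto_trig {y : ∀ n, Fin (n + 1) → ℝ} {s : ∀ n, Finset (Fin (n + 1))}
    {a : ℝ} (ha : 0 < a)
    (hs : Tendsto (fun n : ℕ => (1 / ((n + 1 : ℕ) : ℝ)) * (s n).card) atTop (𝓝 a))
    (hcos : ∀ q : ℚ, Tendsto (fun n : ℕ => (1 / ((n + 1 : ℕ) : ℝ)) * ∑ i ∈ s n,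
      (Real.cos (q * y n i) - ∫ z, Real.cos (q * z) ∂(gaussianReal 0 1))) atTop (𝓝 0))
    (hsin : ∀ q : ℚ, Tendsto (fun n : ℕ => (1 / ((n + 1 : ℕ) : ℝ)) * ∑ i ∈ s n,
      (Real.sin (q * y n i) - ∫ z, Real.sin (q * z) ∂(gaussianReal 0 1))) atTop (𝓝 0))
    {K : ℝ} (hK : ∀ᶠ n : ℕ in atTop, ∑ i, Real.exp (y n i ^ 2 / 32) ≤ K * ((n + 1 : ℕ) : ℝ))
    {f : ℝ → ℝ} (hf : Continuous f) (hfi : Integrable f (gaussianReal 0 1))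
    (hfw : ∀ ε > 0, ∃ R : ℝ, ∀ z, R ≤ |z| → |f z| ≤ ε * Real.exp (z ^ 2 / 32)) :
    Tendsto (fun n : ℕ => (1 / ((n + 1 : ℕ) : ℝ)) * ∑ i ∈ s n, f (y n i)) atTop
      (𝓝 (a * ∫ z, f z ∂(gaussianReal 0 1))) := by
  have hpos : ∀ᶠ n : ℕ in atTop, a / 2 * ((n + 1 : ℕ) : ℝ) < (s n).card := by
    filter_upwards [hs.eventually (lt_mem_nhds (half_lt_self ha))] with n hn
    rwa [one_div, inv_mul_eq_div, lt_div_iff₀ (by positivity)] at hn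
  have hne : ∀ᶠ n : ℕ in atTop, (s n).Nonempty := by
    filter_upwards [hpos] with n hn
    rw [← Finset.card_pos]
    exact_mod_cast (by positivity : 0 ≤ a / 2 * ((n + 1 : ℕ) : ℝ)).trans_lt hn
  -- The empirical measure of an empty set is not a probability measure; a Dirac mass replaces it
  -- for the finitely many such `n`.
  have hex : ∀ n, ∃ ρ : ProbabilityMeasure ℝ,
      ((s n).Nonempty → (ρ : Measure ℝ) = empirical (s n) (y n)) ∧
      ∀ g : ℝ → ℝ, Continuous g → Integrable g (ρ : Measure ℝ) := by
    intro n
    by_cases h : (s n).Nonempty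
    · exact ⟨⟨empirical (s n) (y n), isProbabilityMeasure_empirical h _⟩, fun _ => rfl,
        fun g hg => integrable_empirical h _ hg.stronglyMeasurable⟩
    · exact ⟨⟨Measure.dirac 0, inferInstance⟩, fun h' => absurd h' h,
        fun g hg => integrable_dirac' hg.stronglyMeasurable (by simp)⟩
  choose μ hμ hInt using hex
  let ν : ProbabilityMeasure ℝ := ⟨gaussianReal 0 1, inferInstance⟩
  have hinv : Tendsto (fun n : ℕ => ((n + 1 : ℕ) : ℝ) * ((s n).card : ℝ)⁻¹) atTop (𝓝 a⁻¹) := by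
    refine (hs.inv₀ ha.ne').congr fun n => ?_
    rw [mul_inv, one_div, inv_inv]
  have hsumK : ∀ᶠ n : ℕ in atTop, ((s n).card : ℝ)⁻¹ * ∑ i ∈ s n, Real.exp (y n i ^ 2 / 32)
      ≤ |K| * (2 / a) := by
    filter_upwards [hpos, hK] with n hn hKn
    have hc : (0 : ℝ) < (s n).card := (by positivity : 0 ≤ a / 2 * ((n + 1 : ℕ) : ℝ)).trans_lt hn
    have h1 : ∑ i ∈ s n, Real.exp (y n i ^ 2 / 32) ≤ |K| * ((n + 1 : ℕ) : ℝ) :=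
      ((Finset.sum_le_univ_sum_of_nonneg fun i => (Real.exp_pos _).le).trans hKn).trans
        (by gcongr; exact le_abs_self K)
    rw [inv_mul_le_iff₀ hc]
    refine h1.trans ?_
    calc |K| * ((n + 1 : ℕ) : ℝ) = a / 2 * ((n + 1 : ℕ) : ℝ) * (|K| * (2 / a)) := by
          field_simp
      _ ≤ _ := by gcongr
  have hweak : Tendsto μ atTop (𝓝 ν) := by
    refine ProbabilityMeasure.tendsto_of_tendsto_charFun fun t => ?_
    refine tendsto_of_tendsto_rat (D := 32 * (|K| * (2 / a))) (G := charFun (ν : Measure ℝ))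
      (continuous_charFun) ?_ ?_ t
    · filter_upwards [hne, hsumK] with n hn hKn t t'
      rw [hμ n hn]
      refine (dist_charFun_empirical_le _ _ t t').trans (mul_le_mul_of_nonneg_right ?_ (abs_nonneg _))
      have h1 : ∑ i ∈ s n, |y n i| ≤ 32 * ∑ i ∈ s n, Real.exp (y n i ^ 2 / 32) := by
        rw [Finset.mul_sum]
        exact Finset.sum_le_sum fun i _ => abs_le_mul_exp_sq _
      have h2 := mul_le_mul_of_nonneg_left h1 (by positivity : 0 ≤ ((s n).card : ℝ)⁻¹)
      linarith
    · intro q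
      have h1 := hinv.mul (hcos q)
      have h2 := hinv.mul (hsin q)
      rw [mul_zero] at h1 h2
      have h3 := ((Complex.continuous_ofReal.tendsto 0).comp h1).add
        (((Complex.continuous_ofReal.tendsto 0).comp h2).mul_const Complex.I)
      simp only [Complex.ofReal_zero, zero_mul, add_zero] at h3
      have h4 := h3.add_const (charFun (gaussianReal 0 1) (q : ℝ))
      rw [zero_add] at h4
      refine h4.congr' ?_
      filter_upwards [hne] with n hn
      have hc : ((s n).card : ℂ) ≠ 0 := by
        exact_mod_cast (Finset.card_pos.2 hn).ne'
      have hN : ((n : ℂ) + 1) ≠ 0 := by exact_mod_cast n.succ_ne_zero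
      rw [hμ n hn, charFun_empirical, charFun_gaussianReal_eq]
      simp_rw [cexp_mul_I_eq]
      simp only [Function.comp_apply, Finset.sum_sub_distrib, Finset.sum_const, nsmul_eq_mul,
        Finset.sum_add_distrib, Complex.real_smul, ← Finset.sum_mul]
      push_cast
      field_simp
      ring
  have hlim := tendsto_integral_of_tendsto_of_weight hweak hf
    (w := fun z => Real.exp (z ^ 2 / 32)) (fun z => (Real.exp_pos _).le) (K := |K| * (2 / a))
    (by
      filter_upwards [hne, hsumK] with n hn hKn
      rw [hμ n hn, integral_empirical _ _ (Continuous.stronglyMeasurable (by fun_prop))]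
      exact hKn)
    (fun n => hInt n _ (by fun_prop))
    (by
      refine (memLp_exp_sq_gaussianReal.integrable (by norm_num)).mono' (by fun_prop)
        (ae_of_all _ fun z => ?_)
      rw [Real.norm_of_nonneg (by positivity)]
      gcongr
      norm_num)
    (fun n => hInt n f hf) hfi hfw
  refine (hs.mul hlim).congr' ?_
  filter_upwards [hne] with n hn
  have hc : ((s n).card : ℝ) ≠ 0 := by exact_mod_cast (Finset.card_pos.2 hn).ne'
  rw [hμ n hn, integral_empirical _ _ hf.stronglyMeasurable, smul_eq_mul, mul_assoc,
    mul_inv_cancel_left₀ hc]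

/-! ### Growth of cumulant generating functions -/

section Growth

variable {Ω : Type*} [MeasurableSpace Ω] {P : Measure Ω} [IsProbabilityMeasure P] {Y : Ω → ℝ}

lemma exp_cgf_eq_mgf (hY : ∀ t, Integrable (fun ω => Real.exp (t * Y ω)) P) (t : ℝ) :
    Real.exp (cgf Y P t) = mgf Y P t :=
  Real.exp_log (mgf_pos (hY t))

/-- A cumulant generating function grows at least linearly along rays. -/
lemma mul_cgf_le_cgf_mul (hY : ∀ t, Integrable (fun ω => Real.exp (t * Y ω)) P) (z : ℝ) {p : ℝ}
    (hp : 1 ≤ p) : p * cgf Y P z ≤ cgf Y P (p * z) := by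
  set c := cgf Y P z with hc
  -- Bernoulli's inequality for the `p`-th power of `exp (zY - c)`, a variable of mean one.
  have hpt : ∀ ω, 1 + p * (Real.exp (-c) * Real.exp (z * Y ω) - 1)
      ≤ Real.exp (-(p * c)) * Real.exp (p * z * Y ω) := by
    intro ω
    have h := one_add_mul_self_le_rpow_one_add (s := Real.exp (-c) * Real.exp (z * Y ω) - 1)
      (by linarith [mul_pos (Real.exp_pos (-c)) (Real.exp_pos (z * Y ω))]) hp
    rw [add_sub_cancel, ← Real.exp_add, ← Real.exp_mul] at h
    rw [← Real.exp_add, ← Real.exp_add]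
    refine h.trans (le_of_eq ?_)
    congr 1
    ring
  have i1 : Integrable (fun ω => Real.exp (-c) * Real.exp (z * Y ω)) P := (hY z).const_mul _
  have i2 : Integrable (fun ω => p * (Real.exp (-c) * Real.exp (z * Y ω) - 1)) P :=
    (i1.sub (integrable_const 1)).const_mul p
  have h := integral_mono ((integrable_const (1 : ℝ)).fun_add i2) ((hY (p * z)).const_mul _) hpt
  have e : ∫ ω, (1 + p * (Real.exp (-c) * Real.exp (z * Y ω) - 1)) ∂P = 1 := by
    rw [integral_add (integrable_const 1) i2, integral_const_mul,
      integral_sub i1 (integrable_const 1), integral_const_mul]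
    have : ∫ ω, Real.exp (z * Y ω) ∂P = Real.exp c := (exp_cgf_eq_mgf hY z).symm
    rw [this, ← Real.exp_add]
    simp
  rw [e, integral_const_mul] at h
  have : ∫ ω, Real.exp (p * z * Y ω) ∂P = Real.exp (cgf Y P (p * z)) :=
    (exp_cgf_eq_mgf hY _).symm
  rw [this, ← Real.exp_add, ← Real.exp_zero, Real.exp_le_exp] at h
  linarith

/-- Integrating `2 cosh (zY - c) ≥ 2` gives it. It turns an even upper bound on the cumulant
generating function into a bound on its absolute value. -/
lemma neg_cgf_le_cgf_neg (hY : ∀ t, Integrable (fun ω => Real.exp (t * Y ω)) P) (z : ℝ) :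
    -cgf Y P z ≤ cgf Y P (-z) := by
  set c := cgf Y P z with hc
  have hpt : ∀ ω, 2 ≤ Real.exp (-c) * Real.exp (z * Y ω) + Real.exp c * Real.exp (-z * Y ω) := by
    intro ω
    rw [← Real.exp_add, ← Real.exp_add]
    have e : c + -z * Y ω = -(-c + z * Y ω) := by ring
    rw [e]
    have := Real.one_le_cosh (-c + z * Y ω)
    rw [Real.cosh_eq] at this
    linarith
  have h := integral_mono (integrable_const 2)
    (((hY z).const_mul (Real.exp (-c))).add ((hY (-z)).const_mul (Real.exp c))) hpt
  rw [integral_add' ((hY z).const_mul _) ((hY (-z)).const_mul _), integral_const_mul,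
    integral_const_mul] at h
  have h1 : ∫ ω, Real.exp (z * Y ω) ∂P = Real.exp c := (exp_cgf_eq_mgf hY z).symm
  have h2 : ∫ ω, Real.exp (-z * Y ω) ∂P = Real.exp (cgf Y P (-z)) := (exp_cgf_eq_mgf hY _).symm
  rw [h1, h2, ← Real.exp_add, ← Real.exp_add, neg_add_cancel, Real.exp_zero] at h
  simp only [integral_const, probReal_univ, one_smul] at h
  have h3 : Real.exp 0 ≤ Real.exp (c + cgf Y P (-z)) := by rw [Real.exp_zero]; linarith
  linarith [Real.exp_le_exp.1 h3]

/-- On the interval `x²/2 ≤ v² + 1`. With `v = z/8` the exponent becomes `z²/64 + 1`, the rate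
needed below. -/
lemma gaussianReal_Icc_ge (v : ℝ) :
    (√(2 * Real.pi))⁻¹ * Real.exp (-(v ^ 2 + 1)) ≤ (gaussianReal 0 1).real (Set.Icc v (v + 1)) := by
  rw [measureReal_def, gaussianReal_apply_eq_integral _ one_ne_zero, ENNReal.toReal_ofReal
    (integral_nonneg fun _ => gaussianPDFReal_nonneg _ _ _)]
  have h := setIntegral_ge_of_const_le_real (μ := volume) (s := Set.Icc v (v + 1))
    (f := gaussianPDFReal 0 1) (c := (√(2 * Real.pi))⁻¹ * Real.exp (-(v ^ 2 + 1)))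
    measurableSet_Icc (by simp) (fun x hx => ?_) (integrable_gaussianPDFReal 0 1).integrableOn
  · simpa using h
  · simp only [gaussianPDFReal, NNReal.coe_one, mul_one, sub_zero]
    gcongr
    nlinarith [hx.1, hx.2, sq_nonneg (v - 1)]

/-- Gaussian integrability of a cumulant generating function bounds its growth. -/
lemma exists_cgf_le_exp_sq (hY : ∀ t, Integrable (fun ω => Real.exp (t * Y ω)) P)
    (hI : Integrable (fun v => cgf Y P (8 * v)) (gaussianReal 0 1)) :
    ∃ C : ℝ, 0 ≤ C ∧ ∀ z, 0 ≤ z → cgf Y P z ≤ C * Real.exp (z ^ 2 / 64) := by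
  set I := ∫ v, |cgf Y P (8 * v)| ∂(gaussianReal 0 1) with hIdef
  have hI0 : 0 ≤ I := integral_nonneg fun _ => abs_nonneg _
  refine ⟨I * √(2 * Real.pi) * Real.exp 1, by positivity, fun z hz => ?_⟩
  rcases le_or_gt (cgf Y P z) 0 with h0 | h0
  · exact h0.trans (by positivity)
  have hz0 : 0 < z := lt_of_le_of_ne hz fun h => by simp [← h] at h0
  -- On this window `8v ≥ z`, so growth along rays keeps the positive value at `z` as a lower bound;
  -- Markov's inequality then applies.
  have hsub : Set.Icc (z / 8) (z / 8 + 1) ⊆ {v | cgf Y P z ≤ |cgf Y P (8 * v)|} := by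
    intro v hv
    have hp : 1 ≤ 8 * v / z := by rw [le_div_iff₀ hz0]; linarith [hv.1]
    have h := mul_cgf_le_cgf_mul hY z hp
    rw [div_mul_cancel₀ _ hz0.ne'] at h
    exact (le_mul_of_one_le_left h0.le hp).trans (h.trans (le_abs_self _))
  have h1 := mul_meas_ge_le_integral_of_nonneg (ae_of_all _ fun v => abs_nonneg _) hI.abs
    (cgf Y P z)
  have h2 := (gaussianReal_Icc_ge (z / 8)).trans (measureReal_mono hsub)
  have h3 := (mul_le_mul_of_nonneg_left h2 h0.le).trans h1
  have e : -((z / 8) ^ 2 + 1) = -(z ^ 2 / 64 + 1) := by ring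
  rw [e, Real.exp_neg, Real.exp_add, ← mul_inv, ← div_eq_mul_inv, div_le_iff₀ (by positivity)] at h3
  refine h3.trans (le_of_eq ?_)
  ring

lemma cgf_isLittleO_exp_sq (hY : ∀ t, Integrable (fun ω => Real.exp (t * Y ω)) P)
    (hI : Integrable (fun v => cgf Y P (8 * v)) (gaussianReal 0 1))
    (hI' : Integrable (fun v => cgf Y P (-(8 * v))) (gaussianReal 0 1)) {ε : ℝ} (hε : 0 < ε) :
    ∃ R : ℝ, ∀ z, R ≤ |z| → |cgf Y P z| ≤ ε * Real.exp (z ^ 2 / 32) := by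
  obtain ⟨C₁, hC₁, h₁⟩ := exists_cgf_le_exp_sq hY hI
  obtain ⟨C₂, hC₂, h₂⟩ := exists_cgf_le_exp_sq (Y := -Y) (P := P)
    (fun t => by simpa using hY (-t)) (by simpa only [cgf_neg] using hI')
  have hup : ∀ z, cgf Y P z ≤ (C₁ + C₂) * Real.exp (z ^ 2 / 64) := by
    intro z
    rcases le_total 0 z with hz | hz
    · refine (h₁ z hz).trans ?_
      gcongr
      linarith
    · have := h₂ (-z) (by linarith)
      rw [cgf_neg, neg_neg, neg_sq] at this
      refine this.trans ?_
      gcongr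
      linarith
  -- Chosen so that `C₁ + C₂ ≤ ε|z|/64 ≤ ε exp (z²/64)`; the second inequality uses `|z| ≥ 1`.
  refine ⟨max 1 (64 * (C₁ + C₂) / ε), fun z hz => ?_⟩
  have habs : |cgf Y P z| ≤ (C₁ + C₂) * Real.exp (z ^ 2 / 64) := by
    refine abs_le.2 ⟨?_, hup z⟩
    have := hup (-z)
    rw [neg_sq] at this
    linarith [neg_cgf_le_cgf_neg hY z]
  refine habs.trans ?_
  have e : Real.exp (z ^ 2 / 32) = Real.exp (z ^ 2 / 64) * Real.exp (z ^ 2 / 64) := by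
    rw [← Real.exp_add]; congr 1; ring
  rw [e, ← mul_assoc]
  gcongr
  have hz1 : 1 ≤ |z| := (le_max_left _ _).trans hz
  have hz2 : 64 * (C₁ + C₂) / ε ≤ |z| := (le_max_right _ _).trans hz
  rw [div_le_iff₀ hε] at hz2
  have h3 : |z| / 64 ≤ Real.exp (z ^ 2 / 64) := by
    have := Real.add_one_le_exp (z ^ 2 / 64)
    nlinarith [sq_abs z]
  nlinarith

lemma continuous_cgf (hY : ∀ t, Integrable (fun ω => Real.exp (t * Y ω)) P) :
    Continuous (cgf Y P) :=
  (continuous_mgf hY).log fun t => (mgf_pos (hY t)).ne'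

end Growth

/-! ### Factorisation and length of the weighted walk -/

section Walk

variable {Ω V : Type*} [NormedAddCommGroup V] [InnerProductSpace ℝ V]

lemma logMGF_smul [MeasurableSpace Ω] (P : Measure Ω) (Y : Ω → V) (z : ℝ) (lam : V) :
    logMGF P Y (z • lam) = cgf (fun ω => inner ℝ lam (Y ω)) P z := by
  simp only [logMGF, cgf, mgf, real_inner_smul_left]

lemma mul_inner_walk {n : ℕ} (u : Metric.sphere (0 : EuclideanSpace ℝ (Fin (n + 1))) 1)
    (X : ℕ → Ω → V) (lam : V) (m : ℕ) (ω : Ω) :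
    ((n + 1 : ℕ) : ℝ) * inner ℝ lam (walk u.1 X m ω) =
      ∑ i ∈ Finset.univ.filter (fun i : Fin (n + 1) => (i : ℕ) < m),
        inner ℝ (scaled u i • lam) (X i ω) := by
  have hN : ((n + 1 : ℕ) : ℝ) * (1 / √((n + 1 : ℕ) : ℝ)) = √((n + 1 : ℕ) : ℝ) := by
    rw [mul_one_div, Real.div_sqrt]
  rw [walk, real_inner_smul_right, ← mul_assoc, hN, inner_sum, Finset.mul_sum]
  refine Finset.sum_congr rfl fun i _ => ?_
  rw [real_inner_smul_left, real_inner_smul_right, scaled]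
  ring

variable [MeasurableSpace Ω] [MeasurableSpace V] [BorelSpace V]
  {P : Measure Ω} [IsProbabilityMeasure P] {X : ℕ → Ω → V}

/-- The moment generating function of the weighted walk is finite and factorises. -/
lemma integrable_exp_walk_and_log_integral (hX_meas : ∀ i, Measurable (X i))
    (hX_indep : iIndepFun X P) (hX_ident : ∀ i, IdentDistrib (X i) (X 0) P P)
    (hΛ : ∀ lam : V, Integrable (fun ω => Real.exp (inner ℝ lam (X 0 ω))) P)
    {n : ℕ} (u : Metric.sphere (0 : EuclideanSpace ℝ (Fin (n + 1))) 1) (lam : V) (m : ℕ) :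
    Integrable (fun ω => Real.exp (((n + 1 : ℕ) : ℝ) * inner ℝ lam (walk u.1 X m ω))) P ∧
      Real.log (∫ ω, Real.exp (((n + 1 : ℕ) : ℝ) * inner ℝ lam (walk u.1 X m ω)) ∂P) =
        ∑ i ∈ Finset.univ.filter (fun i : Fin (n + 1) => (i : ℕ) < m),
          logMGF P (X 0) (scaled u i • lam) := by
  set s := Finset.univ.filter (fun i : Fin (n + 1) => (i : ℕ) < m)
  let Z : Fin (n + 1) → Ω → ℝ := fun i ω => inner ℝ (scaled u i • lam) (X i ω)
  have hinner : ∀ v : V, Measurable fun x : V => (inner ℝ v x : ℝ) := fun v =>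
    (by fun_prop : Continuous fun x : V => (inner ℝ v x : ℝ)).measurable
  have hZm : ∀ i, Measurable (Z i) := fun i => (hinner _).comp (hX_meas i)
  have hZi : iIndepFun Z P :=
    (hX_indep.precomp Fin.val_injective).comp (fun i x => inner ℝ (scaled u i • lam) x)
      fun i => hinner _
  have hid : ∀ (i : ℕ) (v : V), IdentDistrib (fun ω => Real.exp (inner ℝ v (X i ω)))
      (fun ω => Real.exp (inner ℝ v (X 0 ω))) P P := fun i v =>
    (hX_ident i).comp (Real.measurable_exp.comp (hinner v))
  have hZe : ∀ i ∈ s, Integrable (fun ω => Real.exp (1 * Z i ω)) P := fun i _ => by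
    simp only [one_mul]
    exact (hid i _).integrable_iff.2 (hΛ _)
  have hsum : ∀ ω, ((n + 1 : ℕ) : ℝ) * inner ℝ lam (walk u.1 X m ω) = 1 * (∑ i ∈ s, Z i) ω :=
    fun ω => by rw [mul_inner_walk, one_mul, Finset.sum_apply]
  simp_rw [hsum]
  refine ⟨hZi.integrable_exp_mul_sum hZm hZe, ?_⟩
  have h := hZi.cgf_sum hZm hZe
  rw [cgf, mgf] at h
  rw [h]
  refine Finset.sum_congr rfl fun i _ => ?_
  rw [cgf, mgf, logMGF]
  simp only [one_mul]
  rw [(hid i _).integral_eq]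

end Walk

lemma card_filter_lt_div {n k : ℕ} :
    (Finset.univ.filter (fun i : Fin (n + 1) => (i : ℕ) < (n + 1) / k)).card = (n + 1) / k := by
  rw [Fin.card_filter_val_lt]
  exact min_eq_right (Nat.div_le_self _ _)

lemma tendsto_card_filter_lt_div (k : ℕ) :
    Tendsto (fun n : ℕ => (1 / ((n + 1 : ℕ) : ℝ)) *
      (Finset.univ.filter (fun i : Fin (n + 1) => (i : ℕ) < (n + 1) / k)).card) atTop
      (𝓝 (1 / (k : ℝ))) := by
  have h := (tendsto_nat_floor_mul_div_atTop (R := ℝ) (a := 1 / (k : ℝ)) (by positivity)).comp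
    (tendsto_natCast_atTop_atTop.comp (tendsto_add_atTop_nat 1))
  refine h.congr fun n => ?_
  rw [card_filter_lt_div]
  simp only [Function.comp_apply]
  rw [one_div_mul_eq_div, Nat.floor_div_eq_div, one_div_mul_eq_div]

end WeightedWalk

/-! ### Assembly on one almost sure event -/

theorem mainTheorem3
    {Ω V : Type*} [MeasurableSpace Ω]
    [NormedAddCommGroup V] [InnerProductSpace ℝ V] [FiniteDimensional ℝ V]
    [MeasurableSpace V] [BorelSpace V]
    (P : Measure Ω) [IsProbabilityMeasure P]
    (X : ℕ → Ω → V)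
    (hX_meas : ∀ i, Measurable (X i))
    (hX_indep : iIndepFun X P)
    (hX_ident : ∀ i, IdentDistrib (X i) (X 0) P P)
    -- `Λ` and `Ψ` are finite on `V`
    (hΛ : ∀ lam : V, Integrable (fun ω => Real.exp (inner ℝ lam (X 0 ω))) P)
    (hΨ : ∀ lam : V, Integrable (fun z : ℝ => WeightedWalk.logMGF P (X 0) (z • lam))
      (gaussianReal 0 1))
    -- `σ` is any probability measure on the product of the spheres with uniform marginals
    (σ : Measure WeightedWalk.WeightArray) [IsProbabilityMeasure σ]
    (hσ : ∀ n, σ.map (fun θ => θ n) = WeightedWalk.uniformSphere n) :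
    ∀ᵐ θ ∂σ, ∀ k : ℕ, 0 < k → ∀ lam : V,
      (∀ n : ℕ, Integrable (fun ω => Real.exp (((n + 1 : ℕ) : ℝ) *
        inner ℝ lam (WeightedWalk.walk (θ n).1 X ((n + 1) / k) ω))) P) ∧
      Tendsto
        (fun n : ℕ => (1 / ((n + 1 : ℕ) : ℝ)) *
          Real.log (∫ ω, Real.exp (((n + 1 : ℕ) : ℝ) *
            inner ℝ lam (WeightedWalk.walk (θ n).1 X ((n + 1) / k) ω)) ∂P))
        atTop (𝓝 ((1 / (k : ℝ)) * WeightedWalk.Psi P (X 0) lam)) := by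
  have lip : ∀ {g : ℝ → ℝ}, LipschitzWith 1 g → ∀ q : ℝ,
      LipschitzWith ‖q‖₊ fun z => g (q * z) := fun hg q => by
    have h := hg.comp (lipschitzWith_smul q : LipschitzWith ‖q‖₊ fun z : ℝ => q • z)
    simpa [Function.comp_def] using h
  have hcos : ∀ᵐ θ ∂σ, ∀ (k : ℕ) (q : ℚ), Tendsto (fun n : ℕ => (1 / ((n + 1 : ℕ) : ℝ)) *
      ∑ i ∈ Finset.univ.filter (fun i : Fin (n + 1) => (i : ℕ) < (n + 1) / k),
        (Real.cos (q * WeightedWalk.scaled (θ n) i)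
          - ∫ z, Real.cos (q * z) ∂(gaussianReal 0 1))) atTop (𝓝 0) :=
    ae_all_iff.2 fun k => ae_all_iff.2 fun q => WeightedWalk.ae_tendsto_sum_scaled hσ
      (lip Real.lipschitzWith_cos q) (fun z => Real.abs_cos_le_one _) _
  have hsin : ∀ᵐ θ ∂σ, ∀ (k : ℕ) (q : ℚ), Tendsto (fun n : ℕ => (1 / ((n + 1 : ℕ) : ℝ)) *
      ∑ i ∈ Finset.univ.filter (fun i : Fin (n + 1) => (i : ℕ) < (n + 1) / k),
        (Real.sin (q * WeightedWalk.scaled (θ n) i)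
          - ∫ z, Real.sin (q * z) ∂(gaussianReal 0 1))) atTop (𝓝 0) :=
    ae_all_iff.2 fun k => ae_all_iff.2 fun q => WeightedWalk.ae_tendsto_sum_scaled hσ
      (lip Real.lipschitzWith_sin q) (fun z => Real.abs_sin_le_one _) _
  obtain ⟨K, hK⟩ := WeightedWalk.exists_ae_eventually_sum_exp_sq_le hσ
  -- The three events involve the weights only, so `k` and `lam` may be fixed after `θ`.
  filter_upwards [hcos, hsin, hK] with θ hcosθ hsinθ hKθ k hk lam
  have hwalk := fun n => WeightedWalk.integrable_exp_walk_and_log_integral hX_meas hX_indep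
    hX_ident hΛ (θ n) lam ((n + 1) / k)
  refine ⟨fun n => (hwalk n).1, ?_⟩
  simp_rw [fun n => (hwalk n).2]
  have hY : ∀ t : ℝ, Integrable (fun ω => Real.exp (t * inner ℝ lam (X 0 ω))) P := fun t => by
    simpa only [real_inner_smul_left] using hΛ (t • lam)
  have hI : ∀ c : ℝ, Integrable (fun v => cgf (fun ω => (inner ℝ lam (X 0 ω) : ℝ)) P (c * v))
      (gaussianReal 0 1) := fun c => by
    refine (hΨ (c • lam)).congr (ae_of_all _ fun v => ?_)
    simp only [smul_smul, WeightedWalk.logMGF_smul, mul_comm v c]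
  simp_rw [WeightedWalk.Psi, WeightedWalk.logMGF_smul]
  refine WeightedWalk.tendsto_sum_of_tendsto_trig (by positivity)
    (WeightedWalk.tendsto_card_filter_lt_div k) (hcosθ k) (hsinθ k) hKθ
    (WeightedWalk.continuous_cgf hY) (by simpa using hI 1) fun ε hε => ?_
  -- Finiteness of `Ψ` at `±8λ`, not only at `λ`, supplies the growth bound.
  exact WeightedWalk.cgf_isLittleO_exp_sq hY (hI 8) (by simpa only [neg_mul] using hI (-8)) hε
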